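/- Let $m\in\{0,1,2,\dots\}$ and let $\alpha,\beta\in\mathbb R$ satisfy $$\alpha,\beta>-1,\qquad \alpha+1-m-\beta\notin\{0,1,\dots,m-1\},\qquad \operatorname{sgn}(\alpha+1-m)=\operatorname{sgn}\beta .$$ Let $P_n^{(a,b)}(x)=\sum_{k=0}^{n}\binom{n+a}{n-k}\binom{n+b}{k}\left(\frac{x-1}{2}\right)^{k}\left(\frac{x+1}{2}\right)^{n-k}$ be the classical Jacobi polynomial (with generalized binomial coefficients, for arbitrary real $a,b$), put $P:=P_m^{(-\alpha-1,\beta-1)}$, and on $(-1,1)$ consider the exceptional $X_m$-Jacobi weight and differential expression $$W_{\alpha,\beta,m}(x)=\frac{(1-x)^\alpha(1+x)^\beta}{P(x)^2},$$ $$T_{\alpha,\beta,m}[y](x)=(1-x^2)y''(x)+\Big(\beta-\alpha-(\beta+\alpha+2)x-2(1-x^2)\tfrac{P'(x)}{P(x)}\Big)y'(x)+\Big((\alpha-\beta-m+1)m-2\beta(1-x)\tfrac{P'(x)}{P(x)}\Big)y(x).$$ Call $T_{\alpha,\beta,m}$ *limit-circle* at an endpoint $e\in\{-1,1\}$ if for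 every $\lambda\in\mathbb C$ every complex-valued solution $y$ of $T_{\alpha,\beta,m}[y]=\lambda y$ near $e$ (that is, on some interval in $(-1,1)$ having $e$ as an endpoint) satisfies $\int|y|^2W_{\alpha,\beta,m}\,dx<\infty$ near $e$, and *limit-point* at $e$ if for every $\lambda\in\mathbb C$ there is a solution near $e$ for which this integral diverges near $e$. Then: 1. $T_{\alpha,\beta,m}$ is limit-point at $x=-1$ if $\beta\ge 1$, and limit-circle at $x=-1$ if $-1<\beta<1$. 2. $T_{\alpha,\beta,m}$ is limit-point at $x=1$ if $\alpha\ge 1$, and limit-circle at $x=1$ if $-1<\alpha<1$, where in the latter assertion the value $\alpha=0$ is excluded when $m\ge 2$. -/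

import Mathlib

open Filter Topology MeasureTheory

noncomputable section

/-- The classical Jacobi polynomial `P_n^{(a,b)}` for arbitrary real parameters `a`, `b`:
`P_n^{(a,b)}(x) = ∑_{k=0}^n C(n+a, n-k) C(n+b, k) ((x-1)/2)^k ((x+1)/2)^(n-k)`,
with generalized binomial coefficients `C(r, k) = r (r-1) ⋯ (r-k+1) / k!`. -/
def jacobiP (n : ℕ) (a b x : ℝ) : ℝ :=
  ∑ k ∈ Finset.range (n + 1),
    Ring.choose ((n : ℝ) + a) (n - k) * Ring.choose ((n : ℝ) + b) k *
      ((x - 1) / 2) ^ k * ((x + 1) / 2) ^ (n - k)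

/-- The polynomial `P_m^{(-α-1, β-1)}` in the denominator of the exceptional weight. -/
def xmDenom (α β : ℝ) (m : ℕ) (x : ℝ) : ℝ :=
  jacobiP m (-α - 1) (β - 1) x

/-- The exceptional `X_m`-Jacobi weight
`W(x) = (1-x)^α (1+x)^β / (P_m^{(-α-1,β-1)}(x))^2`, used for `x ∈ (-1,1)`. -/
def xmWeight (α β : ℝ) (m : ℕ) (x : ℝ) : ℝ :=
  (1 - x) ^ α * (1 + x) ^ β / (xmDenom α β m x) ^ 2

/-- The exceptional `X_m`-Jacobi differential expression `T_{α,β,m}[y](x)`; `logDeriv f = f' / f`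
is the derivative of `log |f|` where `f` does not vanish. -/
def xmJacobiExpr (α β : ℝ) (m : ℕ) (y : ℝ → ℂ) (x : ℝ) : ℂ :=
  ((1 - x ^ 2 : ℝ) : ℂ) * deriv (deriv y) x
  + ((β - α - (β + α + 2) * x - 2 * (1 - x ^ 2) * logDeriv (xmDenom α β m) x : ℝ) : ℂ) * deriv y x
  + (((α - β - m + 1) * m - 2 * β * (1 - x) * logDeriv (xmDenom α β m) x : ℝ) : ℂ) * y x

/-- `y` is a (classical, complex-valued) solution of `T[y] = lam y` near an endpoint.
The endpoint is given by its one-sided neighbourhood filter `l`: for `l = 𝓝[>] a` the equation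
holds on some interval `(a, c)`, for `l = 𝓝[<] b` on some interval `(c, b)`. -/
def IsSolutionNear (T : (ℝ → ℂ) → ℝ → ℂ) (lam : ℂ) (l : Filter ℝ) (y : ℝ → ℂ) : Prop :=
  ∀ᶠ x in l, DifferentiableAt ℝ y x ∧ DifferentiableAt ℝ (deriv y) x ∧ T y x = lam * y x

/-- `y` lies in `L²(W dx)` near the endpoint: `∫ |y|² W dx < ∞` over some one-sided neighbourhood
of the endpoint. -/
def IsSqIntegrableNear (W : ℝ → ℝ) (l : Filter ℝ) (y : ℝ → ℂ) : Prop :=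
  IntegrableAtFilter (fun x => ‖y x‖ ^ 2 * W x) l volume

/-- `T` is limit-circle at the endpoint (with respect to the weight `W`): for every complex `lam`,
all solutions of `T[y] = lam y` near the endpoint are in `L²(W dx)` near the endpoint. -/
def IsLimitCircleAt (T : (ℝ → ℂ) → ℝ → ℂ) (W : ℝ → ℝ) (l : Filter ℝ) : Prop :=
  ∀ (lam : ℂ) (y : ℝ → ℂ), IsSolutionNear T lam l y → IsSqIntegrableNear W l y

/-- `T` is limit-point at the endpoint (with respect to the weight `W`): for every complex `lam`,
there is a solution of `T[y] = lam y` near the endpoint that is not in `L²(W dx)` near the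
endpoint. -/
def IsLimitPointAt (T : (ℝ → ℂ) → ℝ → ℂ) (W : ℝ → ℝ) (l : Filter ℝ) : Prop :=
  ∀ lam : ℂ, ∃ y : ℝ → ℂ, IsSolutionNear T lam l y ∧ ¬ IsSqIntegrableNear W l y

end

/-!
In the distance `t` to either endpoint, `T_{α,β,m}` is an expression `A y'' + B y' + q y` which is
formally symmetric with respect to the weight `w`, where `w` is comparable to `t ^ γ`, `A w` to
`t ^ (γ + 1)`, and `q` is bounded (`IsRegularSingular`). The exponent is `γ = β` at `-1` and
`γ = α - 2 p` at `1`, where `p` is the order of the zero of the denominator polynomial at `1`.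
The solutions therefore behave like combinations of `1` and `t ^ (-γ)` (`1` and `log t` if
`γ = 0`), and only `γ` matters. In terms of `y` and `u = A w y'` the equation `T y = lam y` is the
system `y' = u / (A w)`, `u' = (lam - q) w y`.

* If `-1 < γ < 1`, an energy estimate for the system (`norm_le_rpow_of_singular_system`) bounds
  every solution by `t ^ (-δ)` with `δ` slightly larger than `max γ 0`, which is square integrable
  for the weight: the endpoint is limit-circle.
* If `γ ≥ 1`, a fixed point argument (`exists_solution_singular_system`) gives a solution with
  `u` close to `1`, so that `y` grows like `t ^ (-γ)`. If `γ < -1`, the same argument with the roles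
  of `y` and `u` exchanged gives a solution `y` close to `1`. Neither is square integrable: the
  endpoint is limit-point.

The arithmetic hypotheses force `β ≠ 0`, so the denominator does not vanish at `-1`. At `1` it
vanishes exactly when `α` is an integer in `[0, m)`. Unless `α = 0` and `m ≥ 2`, which is excluded
from the limit-circle claim, this gives `α ≥ 1`; the zero then has order `p = α + 1`, so
`γ = -α - 2 < -1` and the endpoint is limit-point, as for `γ = α ≥ 1`.
-/

/-! ### First-order systems with a regular singular point at `0` -/

/-- Solutions of `y' = f u`, `u' = g y` with `f = O(t^(-γ-1))` and `g = O(t^γ)` grow at most like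
`t^(-δ)` as `t → 0+`, for every `δ ≥ 0` with `γ < δ < γ + 1`: the energy
`t^(2δ) ‖y‖² + ‖u‖²` satisfies `E' ≥ -K E` with `K` integrable at `0`. -/
theorem norm_le_rpow_of_singular_system {γ δ C c : ℝ} {f g y u : ℝ → ℂ}
    (hδ : 0 ≤ δ) (hγδ : γ < δ) (hδγ : δ < γ + 1)
    (hf : ∀ t ∈ Set.Ioo 0 c, ‖f t‖ ≤ C * t ^ (-γ - 1))
    (hg : ∀ t ∈ Set.Ioo 0 c, ‖g t‖ ≤ C * t ^ γ)
    (hy : ∀ t ∈ Set.Ioo 0 c, HasDerivAt y (f t * u t) t)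
    (hu : ∀ t ∈ Set.Ioo 0 c, HasDerivAt u (g t * y t) t) :
    ∃ M, ∀ t ∈ Set.Ioo 0 (c / 2), ‖y t‖ ≤ M * t ^ (-δ) := by
  set E : ℝ → ℝ := fun t => t ^ (2 * δ) * ‖y t‖ ^ 2 + ‖u t‖ ^ 2 with hE
  set G : ℝ → ℝ := fun t => C * (t ^ (δ - γ) / (δ - γ) + t ^ (γ + 1 - δ) / (γ + 1 - δ)) with hG
  have hEd : ∀ t ∈ Set.Ioo 0 c, HasDerivAt E
      ((2 * δ * t ^ (2 * δ - 1)) * ‖y t‖ ^ 2 + t ^ (2 * δ) * (2 * inner ℝ (y t) (f t * u t))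
        + 2 * inner ℝ (u t) (g t * y t)) t := by
    intro t ht
    exact ((Real.hasDerivAt_rpow_const (Or.inl ht.1.ne')).mul (hy t ht).norm_sq).add
      (hu t ht).norm_sq
  have hGd : ∀ t ∈ Set.Ioo 0 c, HasDerivAt G
      (C * (t ^ (δ - γ - 1) + t ^ (γ - δ))) t := by
    intro t ht
    have h1 := (Real.hasDerivAt_rpow_const (x := t) (p := δ - γ) (Or.inl ht.1.ne')).div_const
      (δ - γ)
    have h2 := (Real.hasDerivAt_rpow_const (x := t) (p := γ + 1 - δ) (Or.inl ht.1.ne')).div_const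
      (γ + 1 - δ)
    refine ((h1.add h2).const_mul C).congr_deriv ?_
    have e1 : δ - γ ≠ 0 := by linarith
    have e2 : γ + 1 - δ ≠ 0 := by linarith
    rw [show γ + 1 - δ - 1 = γ - δ by ring]
    field_simp
  have hHd : ∀ t ∈ Set.Ioo 0 c, HasDerivAt (fun t => E t * Real.exp (G t)) _ t :=
    fun t ht => (hEd t ht).mul (hGd t ht).exp
  have hmono : MonotoneOn (fun t => E t * Real.exp (G t)) (Set.Ioo 0 c) := by
    refine monotoneOn_of_deriv_nonneg (convex_Ioo _ _)
      (fun t ht => (hHd t ht).continuousAt.continuousWithinAt)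
      (fun t ht => ?_) (fun t ht => ?_)
    · rw [interior_Ioo] at ht
      exact (hHd t ht).differentiableAt.differentiableWithinAt
    · rw [interior_Ioo] at ht
      rw [(hHd t ht).deriv]
      have ht0 := ht.1
      have i1 : -(‖y t‖ * (‖f t‖ * ‖u t‖)) ≤ inner ℝ (y t) (f t * u t) := by
        rw [← norm_mul]; exact neg_le_of_abs_le (abs_real_inner_le_norm _ _)
      have i2 : -(‖u t‖ * (‖g t‖ * ‖y t‖)) ≤ inner ℝ (u t) (g t * y t) := by
        rw [← norm_mul]; exact neg_le_of_abs_le (abs_real_inner_le_norm _ _)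
      have e0 : t ^ (2 * δ) = t ^ δ * t ^ δ := by
        rw [← Real.rpow_add ht0]; ring_nf
      set v := t ^ δ * ‖y t‖ with hv
      have hv0 : 0 ≤ v := by positivity
      have b1 : t ^ (2 * δ) * (‖y t‖ * (‖f t‖ * ‖u t‖)) ≤ C * t ^ (δ - γ - 1) * (v * ‖u t‖) := by
        have : t ^ (δ - γ - 1) = t ^ δ * t ^ (-γ - 1) := by
          rw [← Real.rpow_add ht0]; ring_nf
        calc t ^ (2 * δ) * (‖y t‖ * (‖f t‖ * ‖u t‖)) = t ^ δ * (v * ‖u t‖) * ‖f t‖ := by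
              rw [e0, hv]; ring
          _ ≤ t ^ δ * (v * ‖u t‖) * (C * t ^ (-γ - 1)) := by gcongr; exact hf t ht
          _ = _ := by rw [this]; ring
      have b2 : ‖u t‖ * (‖g t‖ * ‖y t‖) ≤ C * t ^ (γ - δ) * (v * ‖u t‖) := by
        have : t ^ γ = t ^ (γ - δ) * t ^ δ := by
          rw [← Real.rpow_add ht0]; ring_nf
        calc ‖u t‖ * (‖g t‖ * ‖y t‖) ≤ ‖u t‖ * ((C * t ^ γ) * ‖y t‖) := by
              gcongr; exact hg t ht
          _ = _ := by rw [this, hv]; ring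
      have hE' : E t = v ^ 2 + ‖u t‖ ^ 2 := by simp only [hE, hv, e0]; ring
      have hC : 0 ≤ C * (t ^ (δ - γ - 1) + t ^ (γ - δ)) := by
        have h0 : 0 ≤ C * t ^ γ := (norm_nonneg _).trans (hg t ht)
        have : 0 ≤ C := nonneg_of_mul_nonneg_left h0 (by positivity)
        positivity
      have b3 : 0 ≤ (C * (t ^ (δ - γ - 1) + t ^ (γ - δ))) * (v - ‖u t‖) ^ 2 := by positivity
      have b4 : 0 ≤ (2 * δ * t ^ (2 * δ - 1)) * ‖y t‖ ^ 2 := by positivity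
      have b5 := mul_le_mul_of_nonneg_left i1 (Real.rpow_nonneg ht0.le (2 * δ))
      have : 0 ≤ ((2 * δ * t ^ (2 * δ - 1)) * ‖y t‖ ^ 2
          + t ^ (2 * δ) * (2 * inner ℝ (y t) (f t * u t)) + 2 * inner ℝ (u t) (g t * y t))
          + E t * (C * (t ^ (δ - γ - 1) + t ^ (γ - δ))) := by
        rw [hE']; linarith
      calc (0 : ℝ) ≤ _ * Real.exp (G t) := mul_nonneg this (Real.exp_pos _).le
        _ = _ := by ring
  refine ⟨√(E (c / 2) * Real.exp (G (c / 2))), fun t ht => ?_⟩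
  have hc : 0 < c := by linarith [ht.1, ht.2]
  have ht0 := ht.1
  have htc : t ∈ Set.Ioo 0 c := ⟨ht.1, by linarith [ht.2]⟩
  have h1 := hmono htc ⟨by linarith, by linarith⟩ ht.2.le
  have h2 : 1 ≤ Real.exp (G t) := by
    have : 0 ≤ G t := by
      have h0 : 0 ≤ C * t ^ γ := (norm_nonneg _).trans (hg t htc)
      have : 0 ≤ C := nonneg_of_mul_nonneg_left h0 (by positivity)
      have : 0 < δ - γ := by linarith
      have : 0 < γ + 1 - δ := by linarith
      simp only [hG]; positivity
    exact Real.one_le_exp this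
  have h3 : (t ^ δ * ‖y t‖) ^ 2 ≤ E t := by
    have e0 : t ^ (2 * δ) = t ^ δ * t ^ δ := by
      rw [← Real.rpow_add ht0]; ring_nf
    simp only [hE, e0]; nlinarith [sq_nonneg ‖u t‖]
  have h4 : t ^ δ * ‖y t‖ ≤ √(E (c / 2) * Real.exp (G (c / 2))) := by
    apply Real.le_sqrt_of_sq_le
    have : 0 ≤ E t := (sq_nonneg _).trans h3
    simp only at h1
    nlinarith
  rw [Real.rpow_neg ht0.le, ← div_eq_mul_inv, le_div_iff₀ (by positivity)]
  linarith

/-- If `f = O(t^(-ν-1))` and `g = O(t^ν)` with `ν > 0`, the system `a' = f b`, `b' = g a` has, near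
`0`, a solution whose second component stays close to `1`. It is the fixed point of
`b ↦ 1 - ∫₀ᵗ g(s) ∫ₛᶜ f b`, a contraction of the bounded continuous functions when the interval
`(0, c)` is short. -/
theorem exists_solution_singular_system {ν C c : ℝ} {f g : ℝ → ℂ} (hν : 0 < ν) (hc : 0 < c)
    (hfc : ContinuousOn f (Set.Ioo 0 c)) (hgc : ContinuousOn g (Set.Ioo 0 c))
    (hf : ∀ t ∈ Set.Ioo 0 c, ‖f t‖ ≤ C * t ^ (-ν - 1))
    (hg : ∀ t ∈ Set.Ioo 0 c, ‖g t‖ ≤ C * t ^ ν) :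
    ∃ d ∈ Set.Ioo 0 c, ∃ a b : ℝ → ℂ, ∀ t ∈ Set.Ioo 0 d,
      HasDerivAt a (f t * b t) t ∧ HasDerivAt b (g t * a t) t ∧ ‖b t - 1‖ ≤ 1 / 2 := by
  have hC : 0 ≤ C := by
    have h0 := (norm_nonneg _).trans (hg (c / 2) ⟨by linarith, by linarith⟩)
    exact nonneg_of_mul_nonneg_left h0 (by positivity)
  set D := C * C / ν with hD
  have hD0 : 0 ≤ D := by positivity
  obtain ⟨d, hd0, hdc, hdD⟩ : ∃ d, 0 < d ∧ d < c ∧ D * d ≤ 1 / 3 := by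
    refine ⟨min (c / 2) (1 / (3 * (D + 1))), by positivity, ?_, ?_⟩
    · exact (min_le_left _ _).trans_lt (by linarith)
    · calc D * min (c / 2) (1 / (3 * (D + 1))) ≤ D * (1 / (3 * (D + 1))) := by
            gcongr; exact min_le_right _ _
        _ ≤ 1 / 3 := by
            rw [mul_one_div, div_le_div_iff₀ (by positivity) (by norm_num)]; linarith
  -- the inner integral
  set A : (ℝ → ℂ) → ℝ → ℂ := fun w s => ∫ r in s..d, f r * w r with hA
  have hfw : ∀ w : ℝ → ℂ, Continuous w → ContinuousOn (fun r => f r * w r) (Set.Ioo 0 c) :=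
    fun w hw => hfc.mul hw.continuousOn
  have hsub : ∀ s ∈ Set.Ioo 0 c, ∀ s' ∈ Set.Ioo 0 c, Set.uIcc s s' ⊆ Set.Ioo 0 c :=
    fun s hs s' hs' => Set.ordConnected_Ioo.uIcc_subset hs hs'
  have hdm : d ∈ Set.Ioo 0 c := ⟨hd0, hdc⟩
  have hInt : ∀ w : ℝ → ℂ, Continuous w → ∀ s ∈ Set.Ioo 0 c,
      IntervalIntegrable (fun r => f r * w r) volume s d :=
    fun w hw s hs => ((hfw w hw).mono (hsub s hs d hdm)).intervalIntegrable
  have hAd : ∀ w : ℝ → ℂ, Continuous w → ∀ s ∈ Set.Ioo 0 c,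
      HasDerivAt (A w) (-(f s * w s)) s := by
    intro w hw s hs
    refine intervalIntegral.integral_hasDerivAt_left (hInt w hw s hs) ?_
      ((hfw w hw).continuousAt (isOpen_Ioo.mem_nhds hs))
    exact (hfw w hw).stronglyMeasurableAtFilter isOpen_Ioo s hs
  have hAb : ∀ w : ℝ → ℂ, ∀ N : ℝ, (∀ r, ‖w r‖ ≤ N) → ∀ s ∈ Set.Ioo 0 d,
      ‖g s * A w s‖ ≤ D * N := by
    intro w N hN s hs
    have hs0 := hs.1
    have hN0 : 0 ≤ N := (norm_nonneg _).trans (hN 0)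
    have hsc : s ∈ Set.Ioo 0 c := ⟨hs.1, hs.2.trans hdc⟩
    have h0 : (0 : ℝ) ∉ Set.uIcc s d := fun h => (hsub s hsc d hdm h).1.false
    have hbd : ‖A w s‖ ≤ ∫ r in s..d, C * r ^ (-ν - 1) * N := by
      refine intervalIntegral.norm_integral_le_of_norm_le hs.2.le ?_ ?_
      · refine ae_of_all _ fun r hr => ?_
        have hrc : r ∈ Set.Ioo 0 c := ⟨hs0.trans hr.1, hr.2.trans_lt hdc⟩
        rw [norm_mul]
        exact mul_le_mul (hf r hrc) (hN r) (norm_nonneg _) ((norm_nonneg _).trans (hf r hrc))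
      · exact ((intervalIntegral.intervalIntegrable_rpow (Or.inr h0)).const_mul C).mul_const N
    have hval : (∫ r in s..d, C * r ^ (-ν - 1) * N) ≤ C * N * (s ^ (-ν) / ν) := by
      rw [intervalIntegral.integral_mul_const, intervalIntegral.integral_const_mul,
        integral_rpow (Or.inr ⟨by linarith, h0⟩)]
      have e : (d ^ (-ν - 1 + 1) - s ^ (-ν - 1 + 1)) / (-ν - 1 + 1)
          = s ^ (-ν) / ν - d ^ (-ν) / ν := by
        rw [show -ν - 1 + 1 = -ν by ring]; field_simp; ring
      rw [e]
      have : 0 ≤ d ^ (-ν) / ν := by positivity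
      nlinarith [mul_nonneg (mul_nonneg hC hN0) this]
    calc ‖g s * A w s‖ = ‖g s‖ * ‖A w s‖ := norm_mul _ _
      _ ≤ (C * s ^ ν) * (C * N * (s ^ (-ν) / ν)) :=
          mul_le_mul (hg s hsc) (hbd.trans hval) (norm_nonneg _) (by positivity)
      _ = D * N * (s ^ ν * s ^ (-ν)) := by rw [hD]; ring
      _ = D * N := by rw [← Real.rpow_add hs0]; simp
  -- the outer integrand, extended by zero to the whole line
  set G : (ℝ → ℂ) → ℝ → ℂ := fun w => (Set.Ioo 0 d).indicator fun s => g s * A w s with hG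
  have hGc : ∀ w : ℝ → ℂ, Continuous w → ContinuousOn (fun s => g s * A w s) (Set.Ioo 0 d) :=
    fun w hw s hs => ((hgc.mono (Set.Ioo_subset_Ioo_right hdc.le)) s hs).mul
      (hAd w hw s ⟨hs.1, hs.2.trans hdc⟩).continuousAt.continuousWithinAt
  have hGb : ∀ w : ℝ → ℂ, ∀ N : ℝ, (∀ r, ‖w r‖ ≤ N) → ∀ s, ‖G w s‖ ≤ D * N := by
    intro w N hN s
    by_cases hs : s ∈ Set.Ioo 0 d
    · simp only [hG, Set.indicator_of_mem hs]; exact hAb w N hN s hs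
    · simp only [hG, Set.indicator_of_notMem hs, norm_zero]
      exact mul_nonneg hD0 ((norm_nonneg _).trans (hN 0))
  have hGi : ∀ w : BoundedContinuousFunction ℝ ℂ, ∀ s s' : ℝ,
      IntervalIntegrable (G w) volume s s' := by
    intro w s s'
    have hm : AEStronglyMeasurable (G w) volume :=
      (aestronglyMeasurable_indicator_iff measurableSet_Ioo).2
        ((hGc w w.continuous).aestronglyMeasurable measurableSet_Ioo)
    rw [intervalIntegrable_iff]
    exact Measure.integrableOn_of_bounded (M := D * ‖w‖) (by simp) hm
      (ae_of_all _ fun r => hGb w ‖w‖ w.norm_coe_le_norm r)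
  have hGs : ∀ w w' : BoundedContinuousFunction ℝ ℂ, ∀ s, G w s - G w' s = G (w - w') s := by
    intro w w' s
    by_cases hs : s ∈ Set.Ioo 0 d
    · have hsc : s ∈ Set.Ioo 0 c := ⟨hs.1, hs.2.trans hdc⟩
      simp only [hG, Set.indicator_of_mem hs, ← mul_sub, hA]
      rw [← intervalIntegral.integral_sub (hInt w w.continuous s hsc)
        (hInt w' w'.continuous s hsc)]
      simp [mul_sub]
    · simp [hG, Set.indicator_of_notMem hs]
  -- clamping the upper limit to `[0, d]` makes the primitive bounded on the line
  set κ : ℝ → ℝ := fun t => max 0 (min t d) with hκ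
  have hκc : Continuous κ := by fun_prop
  have hκb : ∀ t, |κ t - 0| ≤ d := by
    intro t
    rw [sub_zero, abs_of_nonneg (le_max_left _ _)]
    exact max_le hd0.le (min_le_right _ _)
  have hPb : ∀ w : ℝ → ℂ, ∀ N : ℝ, (∀ r, ‖w r‖ ≤ N) → ∀ t,
      ‖∫ s in (0 : ℝ)..κ t, G w s‖ ≤ N / 3 := by
    intro w N hN t
    have hN0 : 0 ≤ N := (norm_nonneg _).trans (hN 0)
    calc ‖∫ s in (0 : ℝ)..κ t, G w s‖ ≤ D * N * |κ t - 0| :=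
          intervalIntegral.norm_integral_le_of_norm_le_const fun s _ => hGb w N hN s
      _ ≤ D * N * d := by gcongr; exact hκb t
      _ = D * d * N := by ring
      _ ≤ 1 / 3 * N := by gcongr
      _ = N / 3 := by ring
  set Φ : BoundedContinuousFunction ℝ ℂ → BoundedContinuousFunction ℝ ℂ := fun w =>
    BoundedContinuousFunction.ofNormedAddCommGroup
      (fun t => 1 - ∫ s in (0 : ℝ)..κ t, G w s)
      (continuous_const.sub ((intervalIntegral.continuous_primitive (hGi w) 0).comp hκc))
      (1 + ‖w‖ / 3)
      (fun t => (norm_sub_le _ _).trans (by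
        rw [norm_one]; exact add_le_add_right (hPb w ‖w‖ w.norm_coe_le_norm t) 1)) with hΦ
  have hΦc : ContractingWith (1 / 3) Φ := by
    refine ⟨by rw [← NNReal.coe_lt_coe]; norm_num, LipschitzWith.of_dist_le_mul fun w w' => ?_⟩
    refine (BoundedContinuousFunction.dist_le (by positivity)).2 fun t => ?_
    have e : Φ w t - Φ w' t = -∫ s in (0 : ℝ)..κ t, G (w - w') s := by
      have := intervalIntegral.integral_sub (hGi w 0 (κ t)) (hGi w' 0 (κ t))
      simp only [hGs] at this
      rw [this]
      simp [hΦ]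
    rw [dist_eq_norm, e, norm_neg, dist_eq_norm]
    refine (hPb _ ‖w - w'‖ (fun r => (w - w').norm_coe_le_norm r) t).trans (le_of_eq ?_)
    push_cast; ring
  set b := hΦc.fixedPoint
  have hb : Φ b = b := hΦc.fixedPoint_isFixedPt
  have hbt : ∀ t, b t = 1 - ∫ s in (0 : ℝ)..κ t, G b s := fun t => by
    conv_lhs => rw [← hb]
    rfl
  have hb1 : ∀ t, ‖b t - 1‖ ≤ ‖b‖ / 3 := by
    intro t
    rw [hbt t, sub_sub_cancel_left, norm_neg]
    exact hPb b ‖b‖ b.norm_coe_le_norm t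
  have hbn : ‖b‖ ≤ 3 / 2 := by
    have : ‖b‖ ≤ 1 + ‖b‖ / 3 := by
      refine (BoundedContinuousFunction.norm_le (by positivity)).2 fun t => ?_
      calc ‖b t‖ = ‖1 + (b t - 1)‖ := by ring_nf
        _ ≤ ‖(1 : ℂ)‖ + ‖b t - 1‖ := norm_add_le _ _
        _ ≤ 1 + ‖b‖ / 3 := by rw [norm_one]; exact add_le_add_right (hb1 t) 1
    linarith
  refine ⟨d, hdm, fun t => -A b t, b, fun t ht => ⟨?_, ?_, (hb1 t).trans (by linarith)⟩⟩
  · have h := (hAd b b.continuous t ⟨ht.1, ht.2.trans hdc⟩).neg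
    rw [neg_neg] at h
    exact h
  · have hGt : ContinuousOn (G b) (Set.Ioo 0 d) :=
      (hGc b b.continuous).congr fun s hs => Set.indicator_of_mem hs _
    have h := intervalIntegral.integral_hasDerivAt_right (hGi b 0 t)
      (hGt.stronglyMeasurableAtFilter isOpen_Ioo t ht)
      (hGt.continuousAt (isOpen_Ioo.mem_nhds ht))
    have h2 : HasDerivAt (fun t => 1 - ∫ s in (0 : ℝ)..t, G b s) (-(G b t)) t := h.const_sub 1
    have e : g t * (-A b t) = -(G b t) := by
      simp only [hG, Set.indicator_of_mem ht]; ring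
    rw [e]
    refine h2.congr_of_eventuallyEq ?_
    filter_upwards [isOpen_Ioo.mem_nhds ht] with s hs
    rw [hbt s]
    simp only [hκ, min_eq_left hs.2.le, max_eq_right hs.1.le]

/-! ### Second-order expressions with a regular singular point at `0` -/

/-- The second-order differential expression `A y'' + B y' + q y`. -/
noncomputable def secondOrderExpr (A B q : ℝ → ℝ) (y : ℝ → ℂ) (t : ℝ) : ℂ :=
  (A t : ℂ) * deriv (deriv y) t + (B t : ℂ) * deriv y t + (q t : ℂ) * y t

/-- On `(0, c)` the expression `A y'' + B y' + q y` is formally symmetric with respect to the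
weight `w`, that is `w (A y'' + B y') = (A w y')'`; moreover `w` is comparable to `t ^ γ`, `A w` is
comparable to `t ^ (γ + 1)` and `q` is bounded, all with the constant `C`. The indicial roots at
`0` are then `0` and `-γ`. -/
structure IsRegularSingular (A B q w : ℝ → ℝ) (γ c C : ℝ) : Prop where
  pos : 0 < c
  symm : ∀ t ∈ Set.Ioo 0 c, HasDerivAt (fun t => A t * w t) (B t * w t) t
  A_pos : ∀ t ∈ Set.Ioo 0 c, 0 < A t
  w_pos : ∀ t ∈ Set.Ioo 0 c, 0 < w t
  w_cont : ContinuousOn w (Set.Ioo 0 c)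
  q_cont : ContinuousOn q (Set.Ioo 0 c)
  w_le : ∀ t ∈ Set.Ioo 0 c, w t ≤ C * t ^ γ
  le_w : ∀ t ∈ Set.Ioo 0 c, t ^ γ ≤ C * w t
  Aw_le : ∀ t ∈ Set.Ioo 0 c, A t * w t ≤ C * t ^ (γ + 1)
  le_Aw : ∀ t ∈ Set.Ioo 0 c, t ^ (γ + 1) ≤ C * (A t * w t)
  q_le : ∀ t ∈ Set.Ioo 0 c, |q t| ≤ C

/-- A function bounded below by a positive multiple of `t ^ s`, `s ≤ -1`, is not integrable at
`0+`. -/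
theorem not_integrableAtFilter_of_rpow_le {F : ℝ → ℝ} {k s : ℝ} (hk : 0 < k) (hs : s ≤ -1)
    (hF : ∀ᶠ t in 𝓝[>] (0 : ℝ), k * t ^ s ≤ F t) :
    ¬ IntegrableAtFilter F (𝓝[>] 0) volume := by
  rintro ⟨S, hS, hint⟩
  obtain ⟨ε, hε, hsub⟩ := (mem_nhdsGT_iff_exists_Ioo_subset (a := (0 : ℝ))).1
    (Filter.inter_mem hS hF)
  rw [Set.mem_Ioi] at hε
  have h1 : IntegrableOn (fun t : ℝ => k * t ^ s) (Set.Ioo 0 ε) := by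
    refine Integrable.mono (hint.mono_set fun t ht => (hsub ht).1) ?_ ?_
    · exact ((measurable_id.pow_const s).const_mul k).aestronglyMeasurable
    · refine (ae_restrict_iff' measurableSet_Ioo).2 (ae_of_all _ fun t ht => ?_)
      have h2 : k * t ^ s ≤ F t := (hsub ht).2
      have h3 : 0 ≤ k * t ^ s := mul_nonneg hk.le (Real.rpow_nonneg ht.1.le s)
      rw [Real.norm_of_nonneg h3, Real.norm_of_nonneg (h3.trans h2)]
      exact h2
  have h2 : IntegrableOn (fun t : ℝ => t ^ s) (Set.Ioo 0 ε) := by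
    refine (h1.const_mul k⁻¹).congr (ae_of_all _ fun t => ?_)
    simp [hk.ne']
  have := (intervalIntegral.integrableOn_Ioo_rpow_iff hε).1 h2
  linarith

namespace IsRegularSingular

variable {A B q w : ℝ → ℝ} {γ c C : ℝ}

theorem mono (h : IsRegularSingular A B q w γ c C) {c' : ℝ} (hc' : 0 < c') (hle : c' ≤ c) :
    IsRegularSingular A B q w γ c' C := by
  have hs : Set.Ioo 0 c' ⊆ Set.Ioo 0 c := Set.Ioo_subset_Ioo_right hle
  exact ⟨hc', fun t ht => h.symm t (hs ht), fun t ht => h.A_pos t (hs ht),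
    fun t ht => h.w_pos t (hs ht), h.w_cont.mono hs, h.q_cont.mono hs,
    fun t ht => h.w_le t (hs ht), fun t ht => h.le_w t (hs ht), fun t ht => h.Aw_le t (hs ht),
    fun t ht => h.le_Aw t (hs ht), fun t ht => h.q_le t (hs ht)⟩

theorem Aw_pos (h : IsRegularSingular A B q w γ c C) {t : ℝ} (ht : t ∈ Set.Ioo 0 c) :
    0 < A t * w t := mul_pos (h.A_pos t ht) (h.w_pos t ht)

theorem C_pos (h : IsRegularSingular A B q w γ c C) : 0 < C := by
  have hc := h.pos
  have hm : c / 2 ∈ Set.Ioo 0 c := ⟨by linarith, by linarith⟩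
  have h1 := h.le_w _ hm
  have h2 : 0 < (c / 2) ^ γ := Real.rpow_pos_of_pos hm.1 _
  exact pos_of_mul_pos_left (h2.trans_le h1) (h.w_pos _ hm).le

theorem norm_inv_le (h : IsRegularSingular A B q w γ c C) (lam : ℂ) {t : ℝ}
    (ht : t ∈ Set.Ioo 0 c) :
    ‖(((A t * w t)⁻¹ : ℝ) : ℂ)‖ ≤ (‖lam‖ + C + 1) * C * t ^ (-γ - 1) := by
  have hp := h.Aw_pos ht
  have hC := h.C_pos
  have ht0 : 0 < t ^ (γ + 1) := Real.rpow_pos_of_pos ht.1 _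
  rw [Complex.norm_real, Real.norm_of_nonneg (inv_nonneg.2 hp.le),
    show -γ - 1 = -(γ + 1) by ring, Real.rpow_neg ht.1.le]
  have h1 : (A t * w t)⁻¹ ≤ C * (t ^ (γ + 1))⁻¹ := by
    rw [← div_eq_mul_inv, ← one_div, div_le_div_iff₀ hp ht0]
    linarith [h.le_Aw t ht]
  refine h1.trans ?_
  gcongr
  nlinarith [norm_nonneg lam]

theorem norm_coeff_le (h : IsRegularSingular A B q w γ c C) (lam : ℂ) {t : ℝ}
    (ht : t ∈ Set.Ioo 0 c) :
    ‖(lam - q t) * (w t : ℂ)‖ ≤ (‖lam‖ + C + 1) * C * t ^ γ := by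
  have hw := h.w_pos t ht
  have hC := h.C_pos
  rw [norm_mul, Complex.norm_real, Real.norm_of_nonneg hw.le, mul_assoc]
  have h1 : ‖lam - q t‖ ≤ ‖lam‖ + C + 1 := by
    refine (norm_sub_le _ _).trans ?_
    rw [Complex.norm_real, Real.norm_eq_abs]
    linarith [h.q_le t ht]
  exact mul_le_mul h1 (h.w_le t ht) hw.le (by positivity)

theorem continuousOn_inv (h : IsRegularSingular A B q w γ c C) :
    ContinuousOn (fun t => (((A t * w t)⁻¹ : ℝ) : ℂ)) (Set.Ioo 0 c) :=
  Complex.continuous_ofReal.comp_continuousOn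
    (ContinuousOn.inv₀ (fun t ht => (h.symm t ht).continuousAt.continuousWithinAt)
      fun _ ht => (h.Aw_pos ht).ne')

theorem continuousOn_coeff (h : IsRegularSingular A B q w γ c C) (lam : ℂ) :
    ContinuousOn (fun t => (lam - q t) * (w t : ℂ)) (Set.Ioo 0 c) :=
  (continuousOn_const.sub (Complex.continuous_ofReal.comp_continuousOn h.q_cont)).mul
    (Complex.continuous_ofReal.comp_continuousOn h.w_cont)

/-- A solution of the first-order system for `(y, A w y')` solves the second-order equation. -/
theorem isSolutionNear (h : IsRegularSingular A B q w γ c C) {lam : ℂ} {y u : ℝ → ℂ}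
    (hy : ∀ t ∈ Set.Ioo 0 c, HasDerivAt y ((((A t * w t)⁻¹ : ℝ) : ℂ) * u t) t)
    (hu : ∀ t ∈ Set.Ioo 0 c, HasDerivAt u ((lam - q t) * (w t : ℂ) * y t) t) :
    IsSolutionNear (secondOrderExpr A B q) lam (𝓝[>] 0) y := by
  filter_upwards [Ioo_mem_nhdsGT h.pos] with t ht
  have hp := h.Aw_pos ht
  have hinv : HasDerivAt (fun t => (((A t * w t)⁻¹ : ℝ) : ℂ))
      ((-(B t * w t) / (A t * w t) ^ 2 : ℝ) : ℂ) t :=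
    ((h.symm t ht).inv hp.ne').ofReal_comp
  have hdd : HasDerivAt (deriv y)
      (((-(B t * w t) / (A t * w t) ^ 2 : ℝ) : ℂ) * u t
        + (((A t * w t)⁻¹ : ℝ) : ℂ) * ((lam - q t) * (w t : ℂ) * y t)) t := by
    refine (hinv.mul (hu t ht)).congr_of_eventuallyEq ?_
    filter_upwards [isOpen_Ioo.mem_nhds ht] with s hs
    exact (hy s hs).deriv
  refine ⟨(hy t ht).differentiableAt, hdd.differentiableAt, ?_⟩
  have hA : (A t : ℂ) ≠ 0 := by exact_mod_cast (h.A_pos t ht).ne'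
  have hw : (w t : ℂ) ≠ 0 := by exact_mod_cast (h.w_pos t ht).ne'
  rw [secondOrderExpr, hdd.deriv, (hy t ht).deriv]
  push_cast
  field_simp
  ring

/-- For `-1 < γ < 1` both `1` and `t ^ (-γ)` are square integrable with weight `t ^ γ`, so the
endpoint is limit-circle. -/
theorem isLimitCircleAt (h : IsRegularSingular A B q w γ c C) (h1 : -1 < γ) (h2 : γ < 1) :
    IsLimitCircleAt (secondOrderExpr A B q) w (𝓝[>] 0) := by
  intro lam y hsol
  obtain ⟨e, he, hsub⟩ := (mem_nhdsGT_iff_exists_Ioo_subset (a := (0 : ℝ))).1 hsol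
  rw [Set.mem_Ioi] at he
  obtain ⟨c', hc', hcc, hce⟩ : ∃ c', 0 < c' ∧ c' ≤ c ∧ c' ≤ e :=
    ⟨min c e, lt_min h.pos he, min_le_left _ _, min_le_right _ _⟩
  replace h := h.mono hc' hcc
  replace hsub : ∀ t ∈ Set.Ioo 0 c', DifferentiableAt ℝ y t ∧ DifferentiableAt ℝ (deriv y) t ∧
      secondOrderExpr A B q y t = lam * y t :=
    fun t ht => hsub ⟨ht.1, ht.2.trans_le hce⟩
  obtain ⟨δ, hδ0, hδ1, hδ2⟩ : ∃ δ, 0 ≤ δ ∧ γ < δ ∧ δ < (1 + γ) / 2 := by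
    obtain ⟨δ, hδ, hδ'⟩ := exists_between
      (show max γ 0 < (1 + γ) / 2 from max_lt (by linarith) (by linarith))
    exact ⟨δ, (le_max_right _ _).trans hδ.le, (le_max_left _ _).trans_lt hδ, hδ'⟩
  have hyd : ∀ t ∈ Set.Ioo 0 c', HasDerivAt y
      ((((A t * w t)⁻¹ : ℝ) : ℂ) * (((A t * w t : ℝ) : ℂ) * deriv y t)) t := by
    intro t ht
    refine (hsub t ht).1.hasDerivAt.congr_deriv ?_
    have hp : ((A t * w t : ℝ) : ℂ) ≠ 0 := by exact_mod_cast (h.Aw_pos ht).ne'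
    rw [Complex.ofReal_inv, inv_mul_cancel_left₀ hp]
  have hud : ∀ t ∈ Set.Ioo 0 c', HasDerivAt (fun t => ((A t * w t : ℝ) : ℂ) * deriv y t)
      ((lam - q t) * (w t : ℂ) * y t) t := by
    intro t ht
    refine ((h.symm t ht).ofReal_comp.mul (hsub t ht).2.1.hasDerivAt).congr_deriv ?_
    have hT := (hsub t ht).2.2
    rw [secondOrderExpr] at hT
    push_cast
    linear_combination (w t : ℂ) * hT
  obtain ⟨M, hM⟩ := norm_le_rpow_of_singular_system hδ0 hδ1 (by linarith : δ < γ + 1)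
    (fun t ht => h.norm_inv_le lam ht) (fun t ht => h.norm_coeff_le lam ht) hyd hud
  refine ⟨Set.Ioo 0 (c' / 2), Ioo_mem_nhdsGT (by linarith), ?_⟩
  have hs : Set.Ioo 0 (c' / 2) ⊆ Set.Ioo 0 c' := Set.Ioo_subset_Ioo_right (by linarith)
  have hi : IntegrableOn (fun t : ℝ => M ^ 2 * C * t ^ (γ - 2 * δ)) (Set.Ioo 0 (c' / 2)) :=
    ((intervalIntegral.integrableOn_Ioo_rpow_iff (by linarith)).2 (by linarith)).const_mul _
  refine Integrable.mono' hi ?_ ?_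
  · refine ContinuousOn.aestronglyMeasurable (fun t ht => ?_) measurableSet_Ioo
    exact ((hyd t (hs ht)).continuousAt.norm.pow 2).continuousWithinAt.mul
      ((h.w_cont t (hs ht)).mono hs)
  · refine (ae_restrict_iff' measurableSet_Ioo).2 (ae_of_all _ fun t ht => ?_)
    have hw := h.w_pos t (hs ht)
    rw [Real.norm_of_nonneg (by positivity)]
    have e : t ^ (γ - 2 * δ) = (t ^ (-δ)) ^ 2 * t ^ γ := by
      rw [← Real.rpow_natCast, ← Real.rpow_mul ht.1.le, ← Real.rpow_add ht.1]
      congr 1; push_cast; ring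
    calc ‖y t‖ ^ 2 * w t ≤ (M * t ^ (-δ)) ^ 2 * (C * t ^ γ) :=
          mul_le_mul (pow_le_pow_left₀ (norm_nonneg _) (hM t ht) 2) (h.w_le t (hs ht)) hw.le
            (sq_nonneg _)
      _ = M ^ 2 * C * t ^ (γ - 2 * δ) := by rw [e]; ring

/-- For `γ < -1` a solution that stays close to `1` is not square integrable. -/
theorem isLimitPointAt_of_lt_neg_one (h : IsRegularSingular A B q w γ c C) (hγ : γ < -1) :
    IsLimitPointAt (secondOrderExpr A B q) w (𝓝[>] 0) := by
  intro lam
  obtain ⟨d, hd, u, y, hd'⟩ := exists_solution_singular_system (ν := -γ - 1)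
    (by linarith) h.pos (h.continuousOn_coeff lam) h.continuousOn_inv
    (fun t ht => by
      rw [show -(-γ - 1) - 1 = γ by ring]; exact h.norm_coeff_le lam ht)
    (fun t ht => h.norm_inv_le lam ht)
  replace h := h.mono hd.1 hd.2.le
  have hC := h.C_pos
  refine ⟨y, h.isSolutionNear (fun t ht => (hd' t ht).2.1) (fun t ht => (hd' t ht).1), ?_⟩
  refine not_integrableAtFilter_of_rpow_le (k := 1 / (4 * C)) (by positivity) hγ.le ?_
  filter_upwards [Ioo_mem_nhdsGT hd.1] with t ht
  have hw := h.w_pos t ht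
  have h1 : 1 / 2 ≤ ‖y t‖ := by
    have := norm_sub_norm_le (1 : ℂ) (y t)
    rw [norm_one, norm_sub_rev] at this
    linarith [(hd' t ht).2.2]
  calc 1 / (4 * C) * t ^ γ ≤ 1 / (4 * C) * (C * w t) := by gcongr; exact h.le_w t ht
    _ = (1 / 2) ^ 2 * w t := by field_simp; norm_num
    _ ≤ ‖y t‖ ^ 2 * w t := by gcongr

/-- For `γ ≥ 1` a solution with `A w y'` close to `1` grows like `t ^ (-γ)`, hence is not square
integrable. -/
theorem isLimitPointAt_of_one_le (h : IsRegularSingular A B q w γ c C) (hγ : 1 ≤ γ) :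
    IsLimitPointAt (secondOrderExpr A B q) w (𝓝[>] 0) := by
  intro lam
  have hγ0 : 0 < γ := by linarith
  obtain ⟨d, hd, y, u, hd'⟩ := exists_solution_singular_system hγ0 h.pos h.continuousOn_inv
    (h.continuousOn_coeff lam) (fun t ht => h.norm_inv_le lam ht)
    (fun t ht => h.norm_coeff_le lam ht)
  replace h := h.mono hd.1 hd.2.le
  have hC := h.C_pos
  refine ⟨y, h.isSolutionNear (fun t ht => (hd' t ht).1) (fun t ht => (hd' t ht).2.1), ?_⟩
  set k := 1 / (2 * C * γ) with hk
  have hk0 : 0 < k := by positivity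
  -- `Re y + k t ^ (-γ)` is increasing because `Re (A w y') ≥ 1 / 2`
  have hrd : ∀ t ∈ Set.Ioo 0 d, HasDerivAt (fun t => (y t).re + k * t ^ (-γ))
      ((A t * w t)⁻¹ * (u t).re + k * (-γ * t ^ (-γ - 1))) t := by
    intro t ht
    have h1 : HasDerivAt (fun t => (y t).re) ((A t * w t)⁻¹ * (u t).re) t := by
      have := Complex.reCLM.hasFDerivAt.comp_hasDerivAt t (hd' t ht).1
      rw [Complex.reCLM_apply, Complex.re_ofReal_mul] at this
      exact this
    exact h1.add ((Real.hasDerivAt_rpow_const (Or.inl ht.1.ne')).const_mul k)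
  have hmono : MonotoneOn (fun t => (y t).re + k * t ^ (-γ)) (Set.Ioo 0 d) := by
    refine monotoneOn_of_deriv_nonneg (convex_Ioo _ _)
      (fun t ht => (hrd t ht).continuousAt.continuousWithinAt)
      (fun t ht => ?_) (fun t ht => ?_)
    · rw [interior_Ioo] at ht
      exact (hrd t ht).differentiableAt.differentiableWithinAt
    · rw [interior_Ioo] at ht
      rw [(hrd t ht).deriv]
      have hp := h.Aw_pos ht
      have hu : 1 / 2 ≤ (u t).re := by
        have := (abs_le.1 ((Complex.abs_re_le_norm _).trans (hd' t ht).2.2)).1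
        rw [Complex.sub_re, Complex.one_re] at this
        linarith
      have ht0 : 0 < t ^ (γ + 1) := Real.rpow_pos_of_pos ht.1 _
      have h1 : t ^ (-γ - 1) / C ≤ (A t * w t)⁻¹ := by
        rw [show -γ - 1 = -(γ + 1) by ring, Real.rpow_neg ht.1.le, ← one_div, ← one_div, div_div,
          div_le_div_iff₀ (by positivity) hp]
        linarith [h.Aw_le t ht]
      have h2 : k * (-γ * t ^ (-γ - 1)) = -(t ^ (-γ - 1) / C * (1 / 2)) := by
        rw [hk]; field_simp
      have h3 : t ^ (-γ - 1) / C * (1 / 2) ≤ (A t * w t)⁻¹ * (u t).re :=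
        mul_le_mul h1 hu (by norm_num) (inv_nonneg.2 hp.le)
      rw [h2]; linarith
  set N := (y (d / 2)).re + k * (d / 2) ^ (-γ)
  have hlim : Tendsto (fun t : ℝ => t ^ (-γ)) (𝓝[>] 0) atTop :=
    tendsto_rpow_neg_nhdsGT_zero (by linarith)
  refine not_integrableAtFilter_of_rpow_le (k := k ^ 2 / (4 * C)) (s := -γ) (by positivity)
    (by linarith) ?_
  have hd2 : 0 < d / 2 := by linarith [hd.1]
  filter_upwards [Ioo_mem_nhdsGT hd2, hlim.eventually_ge_atTop (2 * |N| / k)] with t ht hbig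
  have htd : t ∈ Set.Ioo 0 d := ⟨ht.1, by linarith [ht.2]⟩
  have hw := h.w_pos t htd
  have h1 : (y t).re + k * t ^ (-γ) ≤ N := hmono htd ⟨hd2, by linarith⟩ ht.2.le
  have h2 : 2 * |N| ≤ k * t ^ (-γ) := by
    rw [div_le_iff₀ hk0] at hbig; linarith
  have h3 : k / 2 * t ^ (-γ) ≤ ‖y t‖ := by
    have := neg_le_of_abs_le (Complex.abs_re_le_norm (y t))
    linarith [le_abs_self N]
  have e : t ^ (-γ) = (t ^ (-γ)) ^ 2 * t ^ γ := by
    rw [sq, mul_assoc, ← Real.rpow_add ht.1, neg_add_cancel, Real.rpow_zero, mul_one]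
  have ht0 : 0 < t ^ (-γ) := Real.rpow_pos_of_pos ht.1 _
  calc k ^ 2 / (4 * C) * t ^ (-γ) = (k / 2 * t ^ (-γ)) ^ 2 * (t ^ γ / C) := by
        linear_combination k ^ 2 / (4 * C) * e
    _ ≤ ‖y t‖ ^ 2 * w t := by
        refine mul_le_mul (pow_le_pow_left₀ (by positivity) h3 2) ?_
          (div_nonneg (Real.rpow_nonneg ht.1.le _) hC.le) (sq_nonneg _)
        rw [div_le_iff₀ hC]; linarith [h.le_w t htd]

end IsRegularSingular

/-! ### Affine changes of the independent variable -/

theorem deriv_comp_affine (y : ℝ → ℂ) (e σ t : ℝ) :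
    deriv (fun s => y (e + σ * s)) t = σ • deriv y (e + σ * t) := by
  have := deriv_comp_mul_left σ (fun s => y (e + s)) t
  rw [this, deriv_comp_const_add]

theorem deriv_deriv_comp_affine (y : ℝ → ℂ) {e σ : ℝ} (hσ : σ * σ = 1) (t : ℝ) :
    deriv (deriv fun s => y (e + σ * s)) t = deriv (deriv y) (e + σ * t) := by
  have : (deriv fun s => y (e + σ * s)) = fun s => σ • deriv y (e + σ * s) :=
    funext (deriv_comp_affine y e σ)
  rw [this, deriv_fun_const_smul_field, deriv_comp_affine, smul_smul, hσ, one_smul]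

theorem logDeriv_comp_affine (P : ℝ → ℝ) (e σ t : ℝ) :
    logDeriv (fun s => P (e + σ * s)) t = σ * logDeriv P (e + σ * t) := by
  have := deriv_comp_mul_left σ (fun s => P (e + s)) t
  rw [logDeriv_apply, logDeriv_apply, this, deriv_comp_const_add, smul_eq_mul, mul_div_assoc]

theorem IsSolutionNear.comp_affine {T T' : (ℝ → ℂ) → ℝ → ℂ} {lam : ℂ} {l l' : Filter ℝ}
    {y : ℝ → ℂ} {e σ : ℝ} (h : IsSolutionNear T lam l y)
    (hT : ∀ (y : ℝ → ℂ) t, T' (fun s => y (e + σ * s)) t = T y (e + σ * t))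
    (hl : Tendsto (fun t => e + σ * t) l' l) :
    IsSolutionNear T' lam l' (fun s => y (e + σ * s)) := by
  filter_upwards [hl.eventually h] with t ht
  have hφ : DifferentiableAt ℝ (fun s : ℝ => e + σ * s) t := by fun_prop
  refine ⟨ht.1.comp t hφ, ?_, by rw [hT]; exact ht.2.2⟩
  have : (deriv fun s => y (e + σ * s)) = fun s => σ • deriv y (e + σ * s) :=
    funext (deriv_comp_affine y e σ)
  rw [this]
  have h1 : DifferentiableAt ℝ (fun s => deriv y (e + σ * s)) t :=
    DifferentiableAt.comp (g := deriv y) t ht.2.1 hφ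
  exact h1.const_smul σ

theorem integrableAtFilter_comp_affine {F : ℝ → ℝ} {e σ : ℝ} (hσ : σ * σ = 1) {l : Filter ℝ} :
    IntegrableAtFilter (fun t => F (e + σ * t)) l volume ↔
      IntegrableAtFilter F (l.map fun t => e + σ * t) volume := by
  have hemb : MeasurableEmbedding fun t : ℝ => e + σ * t :=
    ((Homeomorph.mulLeft₀ σ (left_ne_zero_of_mul_eq_one hσ)).trans
      (Homeomorph.addLeft e)).measurableEmbedding
  have hmp : (volume : Measure ℝ).map (fun t : ℝ => e + σ * t) = volume := by
    rcases mul_self_eq_one_iff.1 hσ with rfl | rfl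
    · simpa using (measurePreserving_add_left (volume : Measure ℝ) e).map_eq
    · simpa [← sub_eq_add_neg] using (volume.measurePreserving_sub_left e).map_eq
  have := hemb.integrableAtFilter_map_iff (f := F) (l := l) (μ := volume)
  rw [hmp] at this
  exact this.symm

section Transfer

variable {T T' : (ℝ → ℂ) → ℝ → ℂ} {W W' : ℝ → ℝ} {l l' : Filter ℝ} {e σ : ℝ}

theorem IsLimitCircleAt.of_comp_affine (hσ : σ * σ = 1)
    (hT : ∀ (y : ℝ → ℂ) t, T' (fun s => y (e + σ * s)) t = T y (e + σ * t))
    (hW : ∀ t, W' t = W (e + σ * t)) (hl : l'.map (fun t => e + σ * t) = l)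
    (h : IsLimitCircleAt T' W' l') : IsLimitCircleAt T W l := by
  intro lam y hy
  have h1 := h lam _ (hy.comp_affine hT hl.le)
  rw [IsSqIntegrableNear] at h1 ⊢
  simp only [hW] at h1
  rwa [← hl, ← integrableAtFilter_comp_affine hσ]

theorem IsLimitPointAt.of_comp_affine (hσ : σ * σ = 1)
    (hT : ∀ (y : ℝ → ℂ) t, T' (fun s => y (e + σ * s)) t = T y (e + σ * t))
    (hW : ∀ t, W' t = W (e + σ * t)) (hl : l'.map (fun t => e + σ * t) = l)
    (h : IsLimitPointAt T' W' l') : IsLimitPointAt T W l := by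
  intro lam
  obtain ⟨y, hy, hny⟩ := h lam
  -- the inverse of `t ↦ e + σ t` is again affine, with the same slope
  have hinv : ∀ t, -(σ * e) + σ * (e + σ * t) = t := fun t => by linear_combination t * hσ
  have hinv' : ∀ x, e + σ * (-(σ * e) + σ * x) = x := fun x => by
    linear_combination (x - e) * hσ
  refine ⟨fun x => y (-(σ * e) + σ * x), hy.comp_affine (fun y x => ?_) ?_, ?_⟩
  · have := hT (fun x => y (-(σ * e) + σ * x)) (-(σ * e) + σ * x)
    simp only [hinv, hinv'] at this
    exact this.symm
  · rw [← hl, tendsto_map'_iff]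
    exact tendsto_id.congr fun t => (hinv t).symm
  · rw [IsSqIntegrableNear] at hny ⊢
    rw [← hl, ← integrableAtFilter_comp_affine hσ]
    simpa only [hinv, ← hW] using hny

end Transfer

theorem map_affine_nhdsGT_zero_left :
    (𝓝[>] (0 : ℝ)).map (fun t => -1 + 1 * t) = 𝓝[>] (-1) := by
  simp

theorem map_affine_nhdsGT_zero_right :
    (𝓝[>] (0 : ℝ)).map (fun t => 1 + -1 * t) = 𝓝[<] 1 := by
  have := map_subLeft_nhdsGT (c := (1 : ℝ)) (a := 0)
  simpa [sub_eq_add_neg] using this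

/-! ### Exceptional Jacobi expressions in the distance to an endpoint -/

/-- The exceptional Jacobi expression and weight, written in the distance `t` to an endpoint, have
a regular singular point at `0`. Here `R` is the denominator polynomial, with a zero of order `p`
at the endpoint; such a zero turns the exponent `a` of the weight into `a - 2 p`. The hypothesis
`hs` says that the term `s R' / R` of the potential has no pole. -/
theorem exists_isRegularSingular {a b q₀ : ℝ} {p : ℕ} {A B q w R Q s s₁ : ℝ → ℝ}
    (hQ : ContDiff ℝ 1 Q) (hQ0 : Q 0 ≠ 0) (hR : ∀ t, R t = t ^ p * Q t)
    (hs : ∀ t, p * s t = t * s₁ t) (hsc : Continuous s) (hs₁c : Continuous s₁)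
    (hA : ∀ t, A t = t * (2 - t))
    (hB : ∀ t, B t = 2 * (a + 1) - (a + b + 2) * t - 2 * (t * (2 - t)) * logDeriv R t)
    (hq : ∀ t, q t = q₀ + s t * logDeriv R t)
    (hw : ∀ t, w t = t ^ a * (2 - t) ^ b / R t ^ 2) :
    ∃ c C, IsRegularSingular A B q w (a - 2 * p) c C := by
  have hQc : Continuous Q := hQ.continuous
  have hQd : Differentiable ℝ Q := hQ.differentiable one_ne_zero
  have hQ'c : Continuous (deriv Q) := hQ.continuous_deriv le_rfl
  set γ : ℝ := a - 2 * p with hγ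
  set ρ : ℝ → ℝ := fun t => (2 - t) ^ b / Q t ^ 2 with hρ
  set h : ℝ → ℝ := fun t => q₀ + s₁ t + s t * (deriv Q t / Q t) with hh
  have hρc : ∀ t, t < 2 → Q t ≠ 0 → ContinuousAt ρ t := fun t ht hQt =>
    ((continuousAt_const.sub continuousAt_id).rpow_const
      (Or.inl (sub_pos.2 ht).ne')).div (hQc.continuousAt.pow 2) (pow_ne_zero 2 hQt)
  have hhc : ∀ t, Q t ≠ 0 → ContinuousAt h t := fun t hQt =>
    (continuousAt_const.add hs₁c.continuousAt).add
      (hsc.continuousAt.mul (hQ'c.continuousAt.div hQc.continuousAt hQt))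
  have hρ0 : 0 < ρ 0 := by simp only [hρ]; positivity
  have hev : ∀ᶠ t in 𝓝[>] (0 : ℝ), t < 1 ∧ Q t ≠ 0 ∧ ρ t < 2 * ρ 0 ∧ ρ 0 / 2 < ρ t ∧
      |h t| < |h 0| + 1 := by
    refine nhdsWithin_le_nhds ?_
    filter_upwards [eventually_lt_nhds (zero_lt_one' ℝ), hQc.continuousAt.eventually_ne hQ0,
      (hρc 0 two_pos hQ0).eventually_lt_const (show ρ 0 < 2 * ρ 0 by linarith),
      (hρc 0 two_pos hQ0).eventually_const_lt (show ρ 0 / 2 < ρ 0 by linarith),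
      (hhc 0 hQ0).abs.eventually_lt_const (show |h 0| < |h 0| + 1 by linarith)]
      with t h1 h2 h3 h4 h5 using ⟨h1, h2, h3, h4, h5⟩
  obtain ⟨c, hc, hsub⟩ := (mem_nhdsGT_iff_exists_Ioo_subset (a := (0 : ℝ))).1 hev
  rw [Set.mem_Ioi] at hc
  have hlog : ∀ t ∈ Set.Ioo 0 c, HasDerivAt R (R t * (p / t + deriv Q t / Q t)) t := by
    intro t ht
    have hQt := (hsub ht).2.1
    have ht0 := ht.1.ne'
    have h1 := (hasDerivAt_pow p t).mul (hQd t).hasDerivAt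
    rw [show R = fun t => t ^ p * Q t from funext hR]
    refine h1.congr_deriv ?_
    have e : (p : ℝ) * t ^ (p - 1) = t ^ p * (p / t) := by
      rcases p with _ | p
      · simp
      · rw [Nat.add_sub_cancel, pow_succ]; field_simp
    rw [e]; field_simp
  have hRne : ∀ t ∈ Set.Ioo 0 c, R t ≠ 0 := fun t ht => by
    rw [hR]; exact mul_ne_zero (pow_ne_zero _ ht.1.ne') (hsub ht).2.1
  have hlogR : ∀ t ∈ Set.Ioo 0 c, logDeriv R t = p / t + deriv Q t / Q t := fun t ht => by
    rw [logDeriv_apply, (hlog t ht).deriv, mul_div_cancel_left₀ _ (hRne t ht)]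
  have hqh : ∀ t ∈ Set.Ioo 0 c, q t = h t := fun t ht => by
    have ht0 := ht.1.ne'
    have e : s t * (p / t) = s₁ t := by
      field_simp; linarith [hs t]
    rw [hq, hlogR t ht, mul_add, e]; simp only [hh]; ring
  have hwρ : ∀ t ∈ Set.Ioo 0 c, w t = t ^ γ * ρ t := fun t ht => by
    have ht0 : (0 : ℝ) < t := ht.1
    have e : t ^ a = t ^ γ * (t ^ p) ^ 2 := by
      rw [← pow_mul, ← Real.rpow_natCast t (p * 2), ← Real.rpow_add ht0, hγ]
      congr 1; push_cast; ring
    have hQt := (hsub ht).2.1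
    rw [hw, hR, e]; simp only [hρ]; field_simp
  have hpow : ∀ t ∈ Set.Ioo 0 c, t ^ (γ + 1) = t ^ γ * t := fun t ht =>
    Real.rpow_add_one ht.1.ne' γ
  set C := 4 * ρ 0 + 2 / ρ 0 + (|h 0| + 1) with hC
  have hC1 : 4 * ρ 0 ≤ C := by
    have : 0 < 2 / ρ 0 := by positivity
    linarith [abs_nonneg (h 0)]
  have hC2 : 1 ≤ C * (ρ 0 / 2) := by
    have : 2 / ρ 0 ≤ C := by linarith [abs_nonneg (h 0)]
    calc (1 : ℝ) = 2 / ρ 0 * (ρ 0 / 2) := by field_simp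
      _ ≤ _ := by gcongr
  have hC3 : |h 0| + 1 ≤ C := by
    have : 0 < 2 / ρ 0 := by positivity
    linarith
  have hC0 : 0 < C := by linarith
  have hlow : ∀ t ∈ Set.Ioo 0 c, 1 ≤ C * ρ t := fun t ht =>
    hC2.trans (by have := (hsub ht).2.2.2.1; gcongr)
  refine ⟨c, C, ⟨hc, fun t ht => ?_, fun t ht => ?_, fun t ht => ?_, fun t ht => ?_,
    fun t ht => ?_, fun t ht => ?_, fun t ht => ?_, fun t ht => ?_, fun t ht => ?_,
    fun t ht => ?_⟩⟩
  all_goals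
    obtain ⟨h1, hQt, hρ2, hρ1, hht⟩ := hsub ht
    have ht0 : 0 < t := ht.1
    have htγ : 0 < t ^ γ := Real.rpow_pos_of_pos ht0 γ
    have hlo := hlow t ht
  · have h2t : 0 < 2 - t := by linarith
    have hRt := hRne t ht
    have d1 : HasDerivAt (fun t : ℝ => t ^ a) (a * t ^ (a - 1)) t :=
      Real.hasDerivAt_rpow_const (Or.inl ht0.ne')
    have d2 : HasDerivAt (fun t : ℝ => (2 - t) ^ b) (-1 * b * (2 - t) ^ (b - 1)) t :=
      ((hasDerivAt_id t).const_sub 2).rpow_const (Or.inl h2t.ne')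
    have d3 : HasDerivAt (fun t : ℝ => t * (2 - t)) (1 * (2 - t) + t * -1) t :=
      (hasDerivAt_id t).mul ((hasDerivAt_id t).const_sub 2)
    have d4 := (hlog t ht).pow 2
    have d := d3.mul ((d1.mul d2).div d4 (pow_ne_zero 2 hRt))
    rw [show (fun t => A t * w t) = fun t => t * (2 - t) * (t ^ a * (2 - t) ^ b / R t ^ 2) from
      funext fun t => by rw [hA, hw]]
    refine d.congr_deriv ?_
    rw [hB, hw, hlogR t ht, Real.rpow_sub_one ht0.ne', Real.rpow_sub_one h2t.ne']
    simp only [Pi.mul_apply, Pi.div_apply, Pi.pow_apply]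
    field_simp
    ring
  · rw [hA]; exact mul_pos ht0 (by linarith)
  · rw [hwρ t ht]; exact mul_pos htγ (by linarith)
  · refine ContinuousWithinAt.congr ?_ hwρ (hwρ t ht)
    exact ((continuousAt_id.rpow_const (Or.inl ht0.ne')).mul
      (hρc t (by linarith) hQt)).continuousWithinAt
  · exact (hhc t hQt).continuousWithinAt.congr hqh (hqh t ht)
  · rw [hwρ t ht, mul_comm]; gcongr; linarith
  · rw [hwρ t ht]; nlinarith
  · rw [hA, hwρ t ht, hpow t ht]
    calc t * (2 - t) * (t ^ γ * ρ t) = t ^ γ * t * ((2 - t) * ρ t) := by ring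
      _ ≤ t ^ γ * t * C := by gcongr; nlinarith
      _ = _ := by ring
  · rw [hA, hwρ t ht, hpow t ht]
    calc t ^ γ * t ≤ t ^ γ * t * (C * ρ t * (2 - t)) :=
          le_mul_of_one_le_right (by positivity) (one_le_mul_of_one_le_of_one_le hlo (by linarith))
      _ = _ := by ring
  · rw [hqh t ht]; linarith

/-! ### The Jacobi polynomial at the endpoints -/

theorem Ring.choose_ne_zero_of_forall_ne {r : ℝ} {k : ℕ} (h : ∀ j < k, r ≠ j) :
    Ring.choose r k ≠ 0 := by
  have hp : ∀ n : ℕ, (descPochhammer ℤ n).smeval r = ∏ j ∈ Finset.range n, (r - j) := by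
    intro n
    induction n with
    | zero => simp
    | succ n ih =>
      rw [descPochhammer_succ_right, Polynomial.smeval_mul, ih, Finset.prod_range_succ]
      simp [Polynomial.smeval_sub, Polynomial.smeval_natCast]
  rw [Ring.choose_eq_smul, hp]
  refine smul_ne_zero (inv_ne_zero (by exact_mod_cast k.factorial_ne_zero)) ?_
  exact Finset.prod_ne_zero_iff.2 fun j hj => sub_ne_zero.2 (h j (Finset.mem_range.1 hj))

theorem contDiff_jacobiP (n : ℕ) (a b : ℝ) : ContDiff ℝ 1 (jacobiP n a b) := by
  unfold jacobiP
  fun_prop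

theorem jacobiP_neg_one (n : ℕ) (a b : ℝ) :
    jacobiP n a b (-1) = (-1) ^ n * Ring.choose (n + b) n := by
  rw [jacobiP, Finset.sum_eq_single n]
  · norm_num; ring
  · intro k hk hkn
    have : n - k ≠ 0 := by have := Finset.mem_range.1 hk; omega
    simp [this]
  · simp

/-- If the coefficients of `((x - 1) / 2) ^ k` in the definition of `P_n^{(a,b)}` vanish for
`k < p` but not for `k = p`, then `P_n^{(a,b)}` has a zero of order `p` at `1`. -/
theorem exists_jacobiP_eq_pow_mul {n p : ℕ} {a b : ℝ} (hpn : p ≤ n)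
    (h0 : ∀ k < p, Ring.choose (n + a) (n - k) = 0)
    (h1 : Ring.choose (n + a) (n - p) ≠ 0) (h2 : Ring.choose (n + b) p ≠ 0) :
    ∃ Q : ℝ → ℝ, ContDiff ℝ 1 Q ∧ Q 0 ≠ 0 ∧ ∀ t, jacobiP n a b (1 + -1 * t) = t ^ p * Q t := by
  refine ⟨fun t => ∑ k ∈ Finset.range (n + 1), Ring.choose (n + a) (n - k) *
    Ring.choose (n + b) k * ((-1 / 2) ^ k * t ^ (k - p)) * (1 - t / 2) ^ (n - k),
    by fun_prop, ?_, fun t => ?_⟩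
  · simp only
    rw [Finset.sum_eq_single p]
    · simp [h1, h2]
    · intro k _ hkp
      rcases hkp.lt_or_gt with hk | hk
      · simp [h0 k hk]
      · simp [Nat.sub_ne_zero_of_lt hk]
    · intro h; exact absurd (Finset.mem_range.2 (by omega)) h
  · rw [jacobiP, Finset.mul_sum]
    refine Finset.sum_congr rfl fun k _ => ?_
    rcases lt_or_ge k p with hk | hk
    · simp [h0 k hk]
    · have e : ((1 + -1 * t - 1) / 2) ^ k = (-1 / 2) ^ k * (t ^ (k - p) * t ^ p) := by
        rw [← pow_add, Nat.sub_add_cancel hk, ← mul_pow]; congr 1; ring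
      rw [e, show (1 + -1 * t + 1) / 2 = 1 - t / 2 by ring]; ring

/-! ### The exceptional Jacobi expression at the endpoints -/

/-- The expression `T_{α,β,m}` at `e + σ t` as a second-order expression in `t`. -/
theorem secondOrderExpr_comp_affine (α β : ℝ) (m : ℕ) {e σ : ℝ} (hσ : σ * σ = 1) (y : ℝ → ℂ)
    (t : ℝ) :
    secondOrderExpr (fun t => 1 - (e + σ * t) ^ 2)
      (fun t => σ * (β - α - (β + α + 2) * (e + σ * t)
        - 2 * (1 - (e + σ * t) ^ 2) * logDeriv (xmDenom α β m) (e + σ * t)))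
      (fun t => (α - β - m + 1) * m
        - 2 * β * (1 - (e + σ * t)) * logDeriv (xmDenom α β m) (e + σ * t))
      (fun s => y (e + σ * s)) t = xmJacobiExpr α β m y (e + σ * t) := by
  have hσ' : (σ : ℂ) * σ = 1 := by exact_mod_cast hσ
  rw [secondOrderExpr, xmJacobiExpr, deriv_deriv_comp_affine y hσ, deriv_comp_affine,
    Complex.real_smul]
  push_cast
  linear_combination (((β : ℂ) - α - (β + α + 2) * (e + σ * t)
    - 2 * (1 - (e + σ * t) ^ 2) * (logDeriv (xmDenom α β m) (e + σ * t) : ℝ))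
      * deriv y (e + σ * t)) * hσ'

theorem isRegularSingular_left {α β : ℝ} {m : ℕ} (hP : xmDenom α β m (-1) ≠ 0) :
    ∃ c C, IsRegularSingular (fun t => 1 - (-1 + 1 * t) ^ 2)
      (fun t => 1 * (β - α - (β + α + 2) * (-1 + 1 * t)
        - 2 * (1 - (-1 + 1 * t) ^ 2) * logDeriv (xmDenom α β m) (-1 + 1 * t)))
      (fun t => (α - β - m + 1) * m
        - 2 * β * (1 - (-1 + 1 * t)) * logDeriv (xmDenom α β m) (-1 + 1 * t))
      (fun t => xmWeight α β m (-1 + 1 * t)) β c C := by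
  have hL := logDeriv_comp_affine (xmDenom α β m) (-1) 1
  have hP1 : ContDiff ℝ 1 (xmDenom α β m) := contDiff_jacobiP _ _ _
  have := exists_isRegularSingular (a := β) (b := α) (q₀ := (α - β - m + 1) * m) (p := 0)
    (Q := fun s => xmDenom α β m (-1 + 1 * s)) (R := fun s => xmDenom α β m (-1 + 1 * s))
    (s := fun t => -2 * β * (2 - t)) (s₁ := fun _ => 0)
    (A := fun t => 1 - (-1 + 1 * t) ^ 2)
    (B := fun t => 1 * (β - α - (β + α + 2) * (-1 + 1 * t)
        - 2 * (1 - (-1 + 1 * t) ^ 2) * logDeriv (xmDenom α β m) (-1 + 1 * t)))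
    (q := fun t => (α - β - m + 1) * m
        - 2 * β * (1 - (-1 + 1 * t)) * logDeriv (xmDenom α β m) (-1 + 1 * t))
    (w := fun t => xmWeight α β m (-1 + 1 * t))
    (by fun_prop) (by simpa using hP) (by simp) (by simp) (by fun_prop) (by fun_prop)
    (fun t => by ring) (fun t => by rw [hL]; ring) (fun t => by rw [hL]; ring)
    (fun t => by
      rw [xmWeight, show 1 - (-1 + 1 * t) = 2 - t by ring, show 1 + (-1 + 1 * t) = t by ring,
        mul_comm (t ^ β)])
  simpa using this

theorem isRegularSingular_right {α β : ℝ} {m p : ℕ} {Q : ℝ → ℝ} (hQ : ContDiff ℝ 1 Q)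
    (hQ0 : Q 0 ≠ 0) (hP : ∀ t, xmDenom α β m (1 + -1 * t) = t ^ p * Q t) :
    ∃ c C, IsRegularSingular (fun t => 1 - (1 + -1 * t) ^ 2)
      (fun t => -1 * (β - α - (β + α + 2) * (1 + -1 * t)
        - 2 * (1 - (1 + -1 * t) ^ 2) * logDeriv (xmDenom α β m) (1 + -1 * t)))
      (fun t => (α - β - m + 1) * m
        - 2 * β * (1 - (1 + -1 * t)) * logDeriv (xmDenom α β m) (1 + -1 * t))
      (fun t => xmWeight α β m (1 + -1 * t)) (α - 2 * p) c C := by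
  have hL := logDeriv_comp_affine (xmDenom α β m) 1 (-1)
  exact exists_isRegularSingular (a := α) (b := β) (q₀ := (α - β - m + 1) * m) (p := p)
    (Q := Q) (R := fun s => xmDenom α β m (1 + -1 * s))
    (s := fun t => 2 * β * t) (s₁ := fun _ => 2 * β * p)
    hQ hQ0 hP (fun t => by ring) (by fun_prop) (by fun_prop)
    (fun t => by ring) (fun t => by rw [hL]; ring) (fun t => by rw [hL]; ring)
    (fun t => by
      rw [xmWeight, show 1 - (1 + -1 * t) = t by ring, show 1 + (1 + -1 * t) = 2 - t by ring])

theorem mainTheorem4 (m : ℕ) (α β : ℝ) (hα : -1 < α) (hβ : -1 < β)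
    (hdeg : ∀ k : ℕ, k < m → α + 1 - m - β ≠ k)
    (hsgn : SignType.sign (α + 1 - m) = SignType.sign β) :
    (1 ≤ β → IsLimitPointAt (xmJacobiExpr α β m) (xmWeight α β m) (𝓝[>] (-1))) ∧
    (β < 1 → IsLimitCircleAt (xmJacobiExpr α β m) (xmWeight α β m) (𝓝[>] (-1))) ∧
    (1 ≤ α → IsLimitPointAt (xmJacobiExpr α β m) (xmWeight α β m) (𝓝[<] 1)) ∧
    (α < 1 → (2 ≤ m → α ≠ 0) →
      IsLimitCircleAt (xmJacobiExpr α β m) (xmWeight α β m) (𝓝[<] 1)) := by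
  -- the sign condition would turn `β = 0` into `α = m - 1`, which is excluded by `hdeg` or `hα`
  have hβ0 : β ≠ 0 := by
    rintro rfl
    rw [sign_zero, sign_eq_zero_iff] at hsgn
    rcases Nat.eq_zero_or_pos m with rfl | hm
    · push_cast at hsgn; linarith
    · exact hdeg 0 hm (by push_cast; linarith)
  have hleft : xmDenom α β m (-1) ≠ 0 := by
    rw [xmDenom, jacobiP_neg_one]
    refine mul_ne_zero (by simp) (Ring.choose_ne_zero_of_forall_ne fun j hj he => hβ0 ?_)
    have h1 : (j : ℤ) + 1 - m ≤ 0 := by omega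
    have h2 : β = ((j + 1 - m : ℤ) : ℝ) := by push_cast; linarith
    have h3 : (-1 : ℤ) < j + 1 - m := by rw [h2] at hβ; exact_mod_cast hβ
    rw [h2, show (j + 1 - m : ℤ) = 0 by omega, Int.cast_zero]
  obtain ⟨c, C, hL⟩ := isRegularSingular_left hleft
  have hσ : (1 : ℝ) * 1 = 1 := by norm_num
  have hσ' : (-1 : ℝ) * -1 = 1 := by norm_num
  -- the case where the denominator does not vanish at `1`
  have hright : (∀ j < m, (m : ℝ) + (-α - 1) ≠ j) → ∃ Q : ℝ → ℝ, ContDiff ℝ 1 Q ∧ Q 0 ≠ 0 ∧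
      ∀ t, xmDenom α β m (1 + -1 * t) = t ^ 0 * Q t := fun h =>
    exists_jacobiP_eq_pow_mul (Nat.zero_le m) (by simp)
      (by simpa using Ring.choose_ne_zero_of_forall_ne h) (by simp)
  refine ⟨fun h1 => ?_, fun h1 => ?_, fun h1 => ?_, fun h1 h0 => ?_⟩
  · exact (hL.isLimitPointAt_of_one_le h1).of_comp_affine hσ
      (secondOrderExpr_comp_affine α β m hσ) (fun _ => rfl) map_affine_nhdsGT_zero_left
  · exact (hL.isLimitCircleAt hβ h1).of_comp_affine hσ
      (secondOrderExpr_comp_affine α β m hσ) (fun _ => rfl) map_affine_nhdsGT_zero_left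
  · refine IsLimitPointAt.of_comp_affine hσ' (secondOrderExpr_comp_affine α β m hσ')
      (fun _ => rfl) map_affine_nhdsGT_zero_right ?_
    by_cases hz : ∀ j < m, (m : ℝ) + (-α - 1) ≠ j
    · obtain ⟨Q, hQ, hQ0, hP⟩ := hright hz
      obtain ⟨c, C, hR⟩ := isRegularSingular_right hQ hQ0 hP
      exact hR.isLimitPointAt_of_one_le (by simpa using h1)
    · -- here `α = m - 1 - i`, and the denominator has a zero of order `m - i = α + 1` at `1`
      push Not at hz
      obtain ⟨i, him, hi⟩ := hz
      have hp : ((m - i : ℕ) : ℝ) = α + 1 := by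
        rw [Nat.cast_sub him.le]; linarith
      have hβneg : β < 0 := by
        have h2 : α + 1 - m ≤ 0 := by linarith [(Nat.cast_nonneg i : (0 : ℝ) ≤ i)]
        rcases h2.lt_or_eq with h3 | h3
        · rw [sign_neg h3] at hsgn
          exact sign_eq_neg_one_iff.1 hsgn.symm
        · rw [h3, sign_zero] at hsgn
          exact absurd (sign_eq_zero_iff.1 hsgn.symm) hβ0
      obtain ⟨Q, hQ, hQ0, hP⟩ := exists_jacobiP_eq_pow_mul (n := m) (p := m - i) (a := -α - 1)
        (b := β - 1) (Nat.sub_le m i)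
        (fun k hk => by
          rw [hi, Ring.choose_natCast, Nat.choose_eq_zero_of_lt (by omega), Nat.cast_zero])
        (by rw [hi, Nat.sub_sub_self him.le, Ring.choose_natCast]; simp)
        (Ring.choose_ne_zero_of_forall_ne fun j _ he => by
          have h2 : β = ((j + 1 - m : ℤ) : ℝ) := by push_cast; linarith
          rw [h2] at hβ hβneg
          have h3 : (-1 : ℤ) < j + 1 - m := by exact_mod_cast hβ
          have h4 : (j + 1 - m : ℤ) < 0 := by exact_mod_cast hβneg
          omega)
      obtain ⟨c, C, hR⟩ := isRegularSingular_right hQ hQ0 hP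
      exact hR.isLimitPointAt_of_lt_neg_one (by rw [hp]; linarith)
  · -- a zero of the denominator at `1` would force `α = 0`
    obtain ⟨Q, hQ, hQ0, hP⟩ := hright fun j hj he => by
      have h2 : α = ((m - 1 - j : ℤ) : ℝ) := by push_cast; linarith
      have h3 : (m - 1 - j : ℤ) < 1 := by rw [h2] at h1; exact_mod_cast h1
      have h4 : α = 0 := by rw [h2, show (m - 1 - j : ℤ) = 0 by omega, Int.cast_zero]
      have h5 : m = 1 := by
        by_contra hne
        exact h0 (by omega) h4
      subst h5
      rw [h4] at hsgn
      norm_num at hsgn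
      exact hβ0 (sign_eq_zero_iff.1 hsgn.symm)
    obtain ⟨c, C, hR⟩ := isRegularSingular_right hQ hQ0 hP
    refine (hR.isLimitCircleAt ?_ ?_).of_comp_affine hσ'
      (secondOrderExpr_comp_affine α β m hσ') (fun _ => rfl) map_affine_nhdsGT_zero_right
    · simpa using hα
    · simpa using h1
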